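/- Let $L_2(\exp)$ be the two-sorted language of second-order arithmetic (numbers and sets of numbers, with $0,1,+,\cdot,<,\in$) together with a binary symbol for exponentiation. The theory $\mathsf{RCA}_0^*$ has as axioms: the basic axioms of arithmetic ($n+1\neq 0$; $m+1=n+1\to m=n$; $m+0=m$; $m+(n+1)=(m+n)+1$; $m\cdot 0=0$; $m\cdot(n+1)=m\cdot n+m$; $\neg\, m<0$; $m<n+1\leftrightarrow (m<n\vee m=n)$), the exponentiation axioms $m^0=1$ and $m^{n+1}=m^n\cdot m$, induction for all $\Sigma^0_0$ formulas of $L_2(\exp)$, and $\Delta^0_1$ comprehension. Ordered pairs are coded by $(i,j)=(i+j)^2+i$, and a function is a set of pairs that contains exactly one pair $(x,y)$ for each $x$ in its domain. Then the following are equivalent over $\mathsf{RCA}_0^*$, that is, in every model of $\mathsf{RCA}_0^*$ they are either all true or all false: 1. $\mathsf{I}\Sigma^0_1$, the induction scheme for all $\Sigma^0_1$ formulas (with number and set parameters). 2. $\mathsf{ERT}$: for every $k\in\mathbb N$ and every $f:\mathbb N\to\{0,\dots,k-1\}$ there is $b\in\mathbb N$ such that for all $x\ge b$ there is $y\ge b$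 with $x\ne y$ and $f(x)=f(y)$. 3. $\forall j\,\mathsf{ERT}(j)$, where $\mathsf{ERT}(j)$ says: for every $k\in\mathbb N$ and every $f:\mathbb N\to\{0,\dots,k-1\}$ there is $b\in\mathbb N$ such that every value of $f$ that appears at or after $b$ appears at least $j$ times at or after $b$, i.e. for each $x\ge b$ there is a strictly increasing sequence $y_0<y_1<\dots<y_{j-1}$ of numbers $\ge b$ with $f(y_i)=f(x)$ for all $i<j$. -/

import Mathlib

namespace SecondOrderArith

universe u

/-- Number terms of the language `L₂(exp)`: numerical variables `x₀, x₁, …`, the constants `0`, `1`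
and the binary function symbols for addition, multiplication and exponentiation. -/
inductive Term : Type
  | var (i : ℕ)
  | zero
  | one
  | add (s t : Term)
  | mul (s t : Term)
  | exp (s t : Term)

/-- The `Σ⁰₀` formulas of `L₂(exp)`: built from the atomic formulas `s = t`, `s < t`, `t ∈ X_i` by
propositional connectives and the bounded number quantifiers `∀ x < t` and `∃ x < t`, where `x` does
not occur in `t`. Number variables are de Bruijn indices: in the scope of a quantifier the bound
variable is `var 0` and every other index is shifted by one; the bound `t` lies outside the scope.
Free number and set variables serve as parameters. -/
inductive Sigma00 : Type
  | eq (s t : Term)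
  | lt (s t : Term)
  | mem (t : Term) (i : ℕ)
  | not (φ : Sigma00)
  | and (φ ψ : Sigma00)
  | or (φ ψ : Sigma00)
  | imp (φ ψ : Sigma00)
  | ballLT (t : Term) (φ : Sigma00)
  | bexLT (t : Term) (φ : Sigma00)

/-- `push a v` is the sequence `a, v 0, v 1, …`. -/
def push {α : Type u} (a : α) (v : ℕ → α) : ℕ → α
  | 0 => a
  | n + 1 => v n

/-- Structures for `L₂(exp)`: a first-order part `Num`, over which the number variables range, and a
nonempty family `sets` of subsets of it, over which the set variables range. No axioms are imposed
on the operations and on the order. -/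
structure Model : Type (u + 1) where
  Num : Type u
  zero : Num
  one : Num
  add : Num → Num → Num
  mul : Num → Num → Num
  exp : Num → Num → Num
  lt : Num → Num → Prop
  sets : Set (Set Num)
  sets_nonempty : sets.Nonempty

namespace Model

variable (M : Model.{u})

/-- Value of a term under an assignment of the number variables. -/
def eval (v : ℕ → M.Num) : Term → M.Num
  | .var i => v i
  | .zero => M.zero
  | .one => M.one
  | .add s t => M.add (eval v s) (eval v t)
  | .mul s t => M.mul (eval v s) (eval v t)
  | .exp s t => M.exp (eval v s) (eval v t)

/-- Truth of a `Σ⁰₀` formula under an assignment `v` of the number variables and an assignment `V`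
of the set variables. -/
def Sat (V : ℕ → M.sets) : (ℕ → M.Num) → Sigma00 → Prop
  | v, .eq s t => M.eval v s = M.eval v t
  | v, .lt s t => M.lt (M.eval v s) (M.eval v t)
  | v, .mem t i => M.eval v t ∈ (V i : Set M.Num)
  | v, .not φ => ¬ Sat V v φ
  | v, .and φ ψ => Sat V v φ ∧ Sat V v ψ
  | v, .or φ ψ => Sat V v φ ∨ Sat V v ψ
  | v, .imp φ ψ => Sat V v φ → Sat V v ψ
  | v, .ballLT t φ => ∀ a, M.lt a (M.eval v t) → Sat V (push a v) φ
  | v, .bexLT t φ => ∃ a, M.lt a (M.eval v t) ∧ Sat V (push a v) φ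

/-- Truth of the `Σ⁰₁` formula `∃ x θ`. -/
def SatSigma01 (V : ℕ → M.sets) (v : ℕ → M.Num) (θ : Sigma00) : Prop :=
  ∃ a, M.Sat V (push a v) θ

/-- Truth of the `Π⁰₁` formula `∀ x θ`. -/
def SatPi01 (V : ℕ → M.sets) (v : ℕ → M.Num) (θ : Sigma00) : Prop :=
  ∀ a, M.Sat V (push a v) θ

/-- The induction axiom for the predicate `P`. -/
def Induction (P : M.Num → Prop) : Prop :=
  P M.zero → (∀ n, P n → P (M.add n M.one)) → ∀ n, P n

/-- The `Σ⁰₀` induction scheme (all parameters universally quantified). -/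
def ISigma00 : Prop :=
  ∀ (θ : Sigma00) (V : ℕ → M.sets) (v : ℕ → M.Num),
    M.Induction fun n => M.Sat V (push n v) θ

/-- The `Σ⁰₁` induction scheme (all parameters universally quantified). -/
def ISigma01 : Prop :=
  ∀ (θ : Sigma00) (V : ℕ → M.sets) (v : ℕ → M.Num),
    M.Induction fun n => M.SatSigma01 V (push n v) θ

/-- The `Δ⁰₁` (recursive) comprehension scheme: if a `Σ⁰₁` formula `φ(n)` and a `Π⁰₁` formula `ψ(n)`
are equivalent for all `n`, then the set `{n | φ(n)}` exists (all parameters universally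
quantified). -/
def Delta01Comprehension : Prop :=
  ∀ (θ η : Sigma00) (V : ℕ → M.sets) (v : ℕ → M.Num),
    (∀ n, M.SatSigma01 V (push n v) θ ↔ M.SatPi01 V (push n v) η) →
      ∃ X ∈ M.sets, ∀ n, n ∈ X ↔ M.SatSigma01 V (push n v) θ

/-- `M` is a model of `RCA₀*`: basic arithmetic, the recursion equations of exponentiation,
`Σ⁰₀` induction and `Δ⁰₁` comprehension. -/
structure RCA0Star : Prop where
  succ_ne_zero : ∀ n, M.add n M.one ≠ M.zero
  succ_inj : ∀ m n, M.add m M.one = M.add n M.one → m = n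
  add_zero : ∀ m, M.add m M.zero = m
  add_succ : ∀ m n, M.add m (M.add n M.one) = M.add (M.add m n) M.one
  mul_zero : ∀ m, M.mul m M.zero = M.zero
  mul_succ : ∀ m n, M.mul m (M.add n M.one) = M.add (M.mul m n) m
  not_lt_zero : ∀ m, ¬ M.lt m M.zero
  lt_succ : ∀ m n, M.lt m (M.add n M.one) ↔ M.lt m n ∨ m = n
  exp_zero : ∀ m, M.exp m M.zero = M.one
  exp_succ : ∀ m n, M.exp m (M.add n M.one) = M.mul (M.exp m n) m
  sigma00_induction : M.ISigma00
  delta01_comprehension : M.Delta01Comprehension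

/-- The defined relation `m ≤ n`. -/
def le (m n : M.Num) : Prop := M.lt m n ∨ m = n

/-- The standard code `(i, j) = (i + j)² + i` of an ordered pair. -/
def pair (i j : M.Num) : M.Num := M.add (M.mul (M.add i j) (M.add i j)) i

/-- The initial segment `{n | n < k}`, identified with `k` as a set of colors. -/
def below (k : M.Num) : Set M.Num := {n | M.lt n k}

/-- `F` codes a function from `X` to `Y`: it is a set of (codes of) pairs in `X × Y` that contains,
for each `x` in `X`, exactly one pair with first entry `x`. -/
def IsFun (F X Y : Set M.Num) : Prop :=
  (∀ z ∈ F, ∃ x ∈ X, ∃ y ∈ Y, z = M.pair x y) ∧ ∀ x ∈ X, ∃! y, M.pair x y ∈ F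

/-- `x` and `y` have the same value under the function coded by `F`. -/
def SameValue (F : Set M.Num) (x y : M.Num) : Prop :=
  ∃ c, M.pair x c ∈ F ∧ M.pair y c ∈ F

/-- The principle `ERT`: for every `f : ℕ → k` there is `b` such that for each `x ≥ b` there is
`y ≥ b` with `x ≠ y` and `f x = f y`. -/
def ERT : Prop :=
  ∀ k, ∀ F ∈ M.sets, M.IsFun F Set.univ (M.below k) →
    ∃ b, ∀ x, M.le b x → ∃ y, M.le b y ∧ x ≠ y ∧ M.SameValue F x y

/-- Inside `M`: the value at `x` of the function coded by `F` occurs at least `j` times at or after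
`b`, i.e. there is a sequence `y_0 < y_1 < … < y_{j-1}` (a function with domain `{i | i < j}` that
belongs to `M`) of arguments `≥ b` at which the function has the same value as at `x`. -/
def OccursAtLeast (F : Set M.Num) (b x j : M.Num) : Prop :=
  ∃ G ∈ M.sets, M.IsFun G (M.below j) Set.univ ∧
    (∀ i i' y y', M.lt i i' → M.pair i y ∈ G → M.pair i' y' ∈ G → M.lt y y') ∧
    ∀ i y, M.pair i y ∈ G → M.le b y ∧ M.SameValue F x y

/-- The principle `ERT(j)`: for every `f : ℕ → k` there is `b` such that each value of `f` that
appears at or after `b` appears at least `j` times at or after `b`. -/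
def ERTAt (j : M.Num) : Prop :=
  ∀ k, ∀ F ∈ M.sets, M.IsFun F Set.univ (M.below k) →
    ∃ b, ∀ x, M.le b x → M.OccursAtLeast F b x j

end Model

end SecondOrderArith

/-! The implications proved are 1 → 3 → 2 → 1.

From `ISigma01` to `ERTAt j` with j > 0: attach to each s the vector of the numbers of occurrences
below s, modulo j, of the k colors. A vector is a number below j^k, so strong Σ⁰₁ collection yields
t₀ such that every vector that is ever realized is realized before t₀. A second use yields t such
that, for each b < t₀, every color occurring at or after b does so before t. Choose b < t₀ with the
vector of t. A color occurring at or after b has a larger count at t than at b, and the two counts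
are congruent modulo j, so it occurs at least j times in [b, t).

From `ERTAt` to `ERT`: take j = 2.

From `ERT` to `ISigma01`: suppose ∃ x, T n x is inductive but fails at a. Call n verified by stage s
if every m ≤ n has a witness below s. Each n becomes verified at no more than one stage, at every
stage only numbers below a are verified, and the verified numbers keep growing. Color a stage by the
least n that becomes verified there, or by a + 1 if there is none. Then arbitrarily late there are
colors that occur only once, against `ERT`.

Only Σ⁰₀ induction is available at the outset. Digit expansions, bounded with the help of
exponentiation, code sequences by numbers and make counting Σ⁰₀ definable (`exists_code`,
`exists_counting_function`). Strong collection (`ISigma01.strong_collection`) is the one place where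
Σ⁰₁ induction is applied. -/

namespace SecondOrderArith
namespace Model

universe u
variable {M : Model.{u}}

/-! ### Semantic Σ⁰₀ definability with parameters -/

/-- Functions of finitely many number variables given by terms with parameters from `M`. -/
inductive IsTerm (M : Model.{u}) : ∀ {n : ℕ}, ((Fin n → M.Num) → M.Num) → Prop
  | const {n : ℕ} (a : M.Num) : IsTerm M fun _ : Fin n → M.Num => a
  | var {n : ℕ} (i : Fin n) : IsTerm M fun x => x i
  | add {n : ℕ} {s t : (Fin n → M.Num) → M.Num} :
      IsTerm M s → IsTerm M t → IsTerm M fun x => M.add (s x) (t x)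
  | mul {n : ℕ} {s t : (Fin n → M.Num) → M.Num} :
      IsTerm M s → IsTerm M t → IsTerm M fun x => M.mul (s x) (t x)
  | exp {n : ℕ} {s t : (Fin n → M.Num) → M.Num} :
      IsTerm M s → IsTerm M t → IsTerm M fun x => M.exp (s x) (t x)

/-- Relations that are `Σ⁰₀` definable with number and set parameters from `M`. -/
inductive Def (M : Model.{u}) : ∀ {n : ℕ}, ((Fin n → M.Num) → Prop) → Prop
  | eq {n : ℕ} {s t : (Fin n → M.Num) → M.Num} :
      IsTerm M s → IsTerm M t → Def M fun x => s x = t x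
  | lt {n : ℕ} {s t : (Fin n → M.Num) → M.Num} :
      IsTerm M s → IsTerm M t → Def M fun x => M.lt (s x) (t x)
  | mem {n : ℕ} {t : (Fin n → M.Num) → M.Num} {X : Set M.Num} :
      X ∈ M.sets → IsTerm M t → Def M fun x => t x ∈ X
  | not {n : ℕ} {P : (Fin n → M.Num) → Prop} : Def M P → Def M fun x => ¬ P x
  | and {n : ℕ} {P Q : (Fin n → M.Num) → Prop} : Def M P → Def M Q → Def M fun x => P x ∧ Q x
  | or {n : ℕ} {P Q : (Fin n → M.Num) → Prop} : Def M P → Def M Q → Def M fun x => P x ∨ Q x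
  | ball {n : ℕ} {t : (Fin n → M.Num) → M.Num} {P : M.Num → (Fin n → M.Num) → Prop} :
      IsTerm M t → Def M (fun y : Fin (n + 1) → M.Num => P (y 0) (Fin.tail y)) →
      Def M fun x => ∀ a, M.lt a (t x) → P a x
  | bex {n : ℕ} {t : (Fin n → M.Num) → M.Num} {P : M.Num → (Fin n → M.Num) → Prop} :
      IsTerm M t → Def M (fun y : Fin (n + 1) → M.Num => P (y 0) (Fin.tail y)) →
      Def M fun x => ∃ a, M.lt a (t x) ∧ P a x
  | imp {n : ℕ} {P Q : (Fin n → M.Num) → Prop} : Def M P → Def M Q → Def M fun x => P x → Q x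

theorem IsTerm.subst {n : ℕ} {t : (Fin n → M.Num) → M.Num} (ht : IsTerm M t) {m : ℕ}
    {s : (Fin m → M.Num) → Fin n → M.Num} (hs : ∀ i, IsTerm M fun y => s y i) :
    IsTerm M fun y => t (s y) := by
  induction ht with
  | const a => exact .const a
  | var i => exact hs i
  | add _ _ h₁ h₂ => exact .add h₁ h₂
  | mul _ _ h₁ h₂ => exact .mul h₁ h₂
  | exp _ _ h₁ h₂ => exact .exp h₁ h₂

theorem IsTerm.tail {n : ℕ} {t : (Fin n → M.Num) → M.Num} (ht : IsTerm M t) :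
    IsTerm M fun y : Fin (n + 1) → M.Num => t (Fin.tail y) :=
  ht.subst fun i => .var i.succ

theorem IsTerm.cons_tail {n m : ℕ} {s : (Fin m → M.Num) → Fin n → M.Num}
    (hs : ∀ i, IsTerm M fun y => s y i) (i : Fin (n + 1)) :
    IsTerm M fun y : Fin (m + 1) → M.Num =>
      (Fin.cons (y 0) (s (Fin.tail y)) : Fin (n + 1) → M.Num) i := by
  refine Fin.cases ?_ (fun i => ?_) i
  · simpa using IsTerm.var (M := M) (0 : Fin (m + 1))
  · simpa using (hs i).tail

theorem Def.subst {n : ℕ} {P : (Fin n → M.Num) → Prop} (hP : Def M P) {m : ℕ}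
    {s : (Fin m → M.Num) → Fin n → M.Num} (hs : ∀ i, IsTerm M fun y => s y i) :
    Def M fun y => P (s y) := by
  induction hP generalizing m with
  | eq h₁ h₂ => exact .eq (h₁.subst hs) (h₂.subst hs)
  | lt h₁ h₂ => exact .lt (h₁.subst hs) (h₂.subst hs)
  | mem hX h => exact .mem hX (h.subst hs)
  | not _ h => exact .not (h hs)
  | and _ _ h₁ h₂ => exact .and (h₁ hs) (h₂ hs)
  | or _ _ h₁ h₂ => exact .or (h₁ hs) (h₂ hs)
  | imp _ _ h₁ h₂ => exact .imp (h₁ hs) (h₂ hs)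
  | ball ht _ h =>
    refine .ball (ht.subst hs) ?_
    simpa using h (IsTerm.cons_tail hs)
  | bex ht _ h =>
    refine .bex (ht.subst hs) ?_
    simpa using h (IsTerm.cons_tail hs)

/-- The fixed-arity forms let `apply` reuse one definability proof for arbitrary arguments, so that
definability of compound relations is found by alternating them with `constructor`. -/
theorem Def.subst₁ {P : M.Num → Prop} (hP : Def M fun x : Fin 1 → M.Num => P (x 0)) {n : ℕ}
    {t : (Fin n → M.Num) → M.Num} (ht : IsTerm M t) : Def M fun x => P (t x) :=
  hP.subst (s := fun x => ![t x]) fun i => by fin_cases i; exact ht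

theorem Def.subst₂ {P : M.Num → M.Num → Prop}
    (hP : Def M fun x : Fin 2 → M.Num => P (x 0) (x 1)) {n : ℕ}
    {s t : (Fin n → M.Num) → M.Num} (hs : IsTerm M s) (ht : IsTerm M t) :
    Def M fun x => P (s x) (t x) :=
  hP.subst (s := fun x => ![s x, t x]) fun i => by
    fin_cases i
    exacts [hs, ht]

theorem Def.subst₃ {P : M.Num → M.Num → M.Num → Prop}
    (hP : Def M fun x : Fin 3 → M.Num => P (x 0) (x 1) (x 2)) {n : ℕ}
    {r s t : (Fin n → M.Num) → M.Num} (hr : IsTerm M r) (hs : IsTerm M s) (ht : IsTerm M t) :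
    Def M fun x => P (r x) (s x) (t x) :=
  hP.subst (s := fun x => ![r x, s x, t x]) fun i => by
    fin_cases i
    exacts [hr, hs, ht]

theorem Def.subst₄ {P : M.Num → M.Num → M.Num → M.Num → Prop}
    (hP : Def M fun x : Fin 4 → M.Num => P (x 0) (x 1) (x 2) (x 3)) {n : ℕ}
    {q r s t : (Fin n → M.Num) → M.Num} (hq : IsTerm M q) (hr : IsTerm M r) (hs : IsTerm M s)
    (ht : IsTerm M t) :
    Def M fun x => P (q x) (r x) (s x) (t x) :=
  hP.subst (s := fun x => ![q x, r x, s x, t x]) fun i => by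
    fin_cases i
    exacts [hq, hr, hs, ht]

theorem IsTerm.eval {n : ℕ} {e : (Fin n → M.Num) → ℕ → M.Num}
    (he : ∀ i, IsTerm M fun x => e x i) (τ : Term) : IsTerm M fun x => M.eval (e x) τ := by
  induction τ with
  | var i => exact he i
  | zero => exact .const _
  | one => exact .const _
  | add _ _ h₁ h₂ => exact .add h₁ h₂
  | mul _ _ h₁ h₂ => exact .mul h₁ h₂
  | exp _ _ h₁ h₂ => exact .exp h₁ h₂

theorem IsTerm.push_tail {n : ℕ} {e : (Fin n → M.Num) → ℕ → M.Num}
    (he : ∀ i, IsTerm M fun x => e x i) (i : ℕ) :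
    IsTerm M fun y : Fin (n + 1) → M.Num => push (y 0) (e (Fin.tail y)) i := by
  cases i with
  | zero => exact .var 0
  | succ i => exact (he i).tail

/-- Satisfaction of a `Σ⁰₀` formula is definable. -/
theorem Def.sat (V : ℕ → M.sets) (θ : Sigma00) {n : ℕ} {e : (Fin n → M.Num) → ℕ → M.Num}
    (he : ∀ i, IsTerm M fun x => e x i) : Def M fun x => M.Sat V (e x) θ := by
  induction θ generalizing n with
  | eq s t => exact .eq (.eval he s) (.eval he t)
  | lt s t => exact .lt (.eval he s) (.eval he t)
  | mem t i => exact .mem (V i).2 (.eval he t)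
  | not _ h => exact .not (h he)
  | and _ _ h₁ h₂ => exact .and (h₁ he) (h₂ he)
  | or _ _ h₁ h₂ => exact .or (h₁ he) (h₂ he)
  | imp _ _ h₁ h₂ => exact .imp (h₁ he) (h₂ he)
  | ballLT t _ h => exact .ball (.eval he t) (h (IsTerm.push_tail he))
  | bexLT t _ h => exact .bex (.eval he t) (h (IsTerm.push_tail he))

/-! ### From definable relations to formulas -/

/-- The assignment with values `x 0, …, x (n - 1), v 0, v 1, …`. -/
def prepend {α : Type u} : ∀ {n : ℕ}, (Fin n → α) → (ℕ → α) → ℕ → α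
  | 0, _, v => v
  | _ + 1, x, v => push (x 0) (prepend (Fin.tail x) v)

theorem prepend_lt {α : Type u} {n : ℕ} (x : Fin n → α) (v : ℕ → α) (i : Fin n) :
    prepend x v i = x i := by
  induction n with
  | zero => exact i.elim0
  | succ n ih =>
    refine Fin.cases rfl (fun i => ?_) i
    exact ih (Fin.tail x) i

theorem prepend_add {α : Type u} {n : ℕ} (x : Fin n → α) (v : ℕ → α) (i : ℕ) :
    prepend x v (i + n) = v i := by
  induction n with
  | zero => rfl
  | succ n ih => exact ih (Fin.tail x)

/-- The term is required for every assignment v that lists the finitely many parameters. Subterms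
can therefore share one v, and no renaming of variables is needed when they are combined. -/
theorem IsTerm.exists_term {n : ℕ} {t : (Fin n → M.Num) → M.Num} (ht : IsTerm M t) :
    ∃ A : List M.Num, ∀ v : ℕ → M.Num, (∀ a ∈ A, ∃ i, v i = a) →
      ∃ τ : Term, ∀ x, M.eval (prepend x v) τ = t x := by
  induction ht with
  | const a =>
    refine ⟨[a], fun v hv => ?_⟩
    obtain ⟨i, rfl⟩ := hv a (by simp)
    exact ⟨.var (i + n), fun x => prepend_add x v i⟩
  | var i => exact ⟨[], fun v _ => ⟨.var i, fun x => prepend_lt x v i⟩⟩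
  | add _ _ h₁ h₂ =>
    obtain ⟨A, hA⟩ := h₁
    obtain ⟨B, hB⟩ := h₂
    refine ⟨A ++ B, fun v hv => ?_⟩
    obtain ⟨σ, hσ⟩ := hA v fun a ha => hv a (by simp [ha])
    obtain ⟨τ, hτ⟩ := hB v fun a ha => hv a (by simp [ha])
    exact ⟨.add σ τ, fun x => by simp [Model.eval, hσ, hτ]⟩
  | mul _ _ h₁ h₂ =>
    obtain ⟨A, hA⟩ := h₁
    obtain ⟨B, hB⟩ := h₂
    refine ⟨A ++ B, fun v hv => ?_⟩
    obtain ⟨σ, hσ⟩ := hA v fun a ha => hv a (by simp [ha])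
    obtain ⟨τ, hτ⟩ := hB v fun a ha => hv a (by simp [ha])
    exact ⟨.mul σ τ, fun x => by simp [Model.eval, hσ, hτ]⟩
  | exp _ _ h₁ h₂ =>
    obtain ⟨A, hA⟩ := h₁
    obtain ⟨B, hB⟩ := h₂
    refine ⟨A ++ B, fun v hv => ?_⟩
    obtain ⟨σ, hσ⟩ := hA v fun a ha => hv a (by simp [ha])
    obtain ⟨τ, hτ⟩ := hB v fun a ha => hv a (by simp [ha])
    exact ⟨.exp σ τ, fun x => by simp [Model.eval, hσ, hτ]⟩

/-- `v` and `V` list all parameters in `A` and `S`. -/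
def Lists (A : List M.Num) (S : List M.sets) (v : ℕ → M.Num) (V : ℕ → M.sets) : Prop :=
  (∀ a ∈ A, ∃ i, v i = a) ∧ ∀ X ∈ S, ∃ i, V i = X

theorem Lists.append_left {A B : List M.Num} {S T : List M.sets} {v : ℕ → M.Num}
    {V : ℕ → M.sets} (h : Lists (A ++ B) (S ++ T) v V) : Lists A S v V :=
  ⟨fun a ha => h.1 a (by simp [ha]), fun X hX => h.2 X (by simp [hX])⟩

theorem Lists.append_right {A B : List M.Num} {S T : List M.sets} {v : ℕ → M.Num}
    {V : ℕ → M.sets} (h : Lists (A ++ B) (S ++ T) v V) : Lists B T v V :=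
  ⟨fun a ha => h.1 a (by simp [ha]), fun X hX => h.2 X (by simp [hX])⟩

theorem Def.exists_formula_of_lists {n : ℕ} {P : (Fin n → M.Num) → Prop} (hP : Def M P) :
    ∃ (A : List M.Num) (S : List M.sets), ∀ v V, Lists A S v V →
      ∃ θ : Sigma00, ∀ x, M.Sat V (prepend x v) θ ↔ P x := by
  induction hP with
  | eq h₁ h₂ =>
    obtain ⟨A, hA⟩ := h₁.exists_term
    obtain ⟨B, hB⟩ := h₂.exists_term
    refine ⟨A ++ B, [] ++ [], fun v V hv => ?_⟩
    obtain ⟨σ, hσ⟩ := hA v hv.append_left.1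
    obtain ⟨τ, hτ⟩ := hB v hv.append_right.1
    exact ⟨.eq σ τ, fun x => by simp [Sat, hσ, hτ]⟩
  | lt h₁ h₂ =>
    obtain ⟨A, hA⟩ := h₁.exists_term
    obtain ⟨B, hB⟩ := h₂.exists_term
    refine ⟨A ++ B, [] ++ [], fun v V hv => ?_⟩
    obtain ⟨σ, hσ⟩ := hA v hv.append_left.1
    obtain ⟨τ, hτ⟩ := hB v hv.append_right.1
    exact ⟨.lt σ τ, fun x => by simp [Sat, hσ, hτ]⟩
  | @mem _ _ X hX h =>
    obtain ⟨A, hA⟩ := h.exists_term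
    refine ⟨A, [⟨X, hX⟩], fun v V hv => ?_⟩
    obtain ⟨τ, hτ⟩ := hA v hv.1
    obtain ⟨i, hi⟩ := hv.2 ⟨X, hX⟩ (by simp)
    exact ⟨.mem τ i, fun x => by simp [Sat, hτ, hi]⟩
  | not _ h =>
    obtain ⟨A, S, h⟩ := h
    refine ⟨A, S, fun v V hv => ?_⟩
    obtain ⟨θ, hθ⟩ := h v V hv
    exact ⟨.not θ, fun x => by simp [Sat, hθ]⟩
  | and _ _ h₁ h₂ =>
    obtain ⟨A, S, h₁⟩ := h₁
    obtain ⟨B, T, h₂⟩ := h₂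
    refine ⟨A ++ B, S ++ T, fun v V hv => ?_⟩
    obtain ⟨θ, hθ⟩ := h₁ v V hv.append_left
    obtain ⟨η, hη⟩ := h₂ v V hv.append_right
    exact ⟨.and θ η, fun x => by simp [Sat, hθ, hη]⟩
  | or _ _ h₁ h₂ =>
    obtain ⟨A, S, h₁⟩ := h₁
    obtain ⟨B, T, h₂⟩ := h₂
    refine ⟨A ++ B, S ++ T, fun v V hv => ?_⟩
    obtain ⟨θ, hθ⟩ := h₁ v V hv.append_left
    obtain ⟨η, hη⟩ := h₂ v V hv.append_right
    exact ⟨.or θ η, fun x => by simp [Sat, hθ, hη]⟩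
  | imp _ _ h₁ h₂ =>
    obtain ⟨A, S, h₁⟩ := h₁
    obtain ⟨B, T, h₂⟩ := h₂
    refine ⟨A ++ B, S ++ T, fun v V hv => ?_⟩
    obtain ⟨θ, hθ⟩ := h₁ v V hv.append_left
    obtain ⟨η, hη⟩ := h₂ v V hv.append_right
    exact ⟨.imp θ η, fun x => by simp [Sat, hθ, hη]⟩
  | ball ht _ h =>
    obtain ⟨A, hA⟩ := ht.exists_term
    obtain ⟨B, T, h⟩ := h
    refine ⟨A ++ B, [] ++ T, fun v V hv => ?_⟩
    obtain ⟨τ, hτ⟩ := hA v hv.append_left.1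
    obtain ⟨θ, hθ⟩ := h v V hv.append_right
    refine ⟨.ballLT τ θ, fun x => ?_⟩
    simp only [Sat, hτ]
    exact forall₂_congr fun a _ => hθ (Fin.cons a x)
  | bex ht _ h =>
    obtain ⟨A, hA⟩ := ht.exists_term
    obtain ⟨B, T, h⟩ := h
    refine ⟨A ++ B, [] ++ T, fun v V hv => ?_⟩
    obtain ⟨τ, hτ⟩ := hA v hv.append_left.1
    obtain ⟨θ, hθ⟩ := h v V hv.append_right
    refine ⟨.bexLT τ θ, fun x => ?_⟩
    simp only [Sat, hτ]
    exact exists_congr fun a => and_congr_right fun _ => hθ (Fin.cons a x)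

theorem Def.exists_formula {n : ℕ} {P : (Fin n → M.Num) → Prop} (hP : Def M P) :
    ∃ (θ : Sigma00) (V : ℕ → M.sets) (v : ℕ → M.Num), ∀ x, M.Sat V (prepend x v) θ ↔ P x := by
  obtain ⟨A, S, h⟩ := hP.exists_formula_of_lists
  obtain ⟨X, hX⟩ := M.sets_nonempty
  have hL : Lists A S (fun i => A.getD i M.zero) (fun i => S.getD i ⟨X, hX⟩) := by
    refine ⟨fun a ha => ?_, fun Y hY => ?_⟩
    · obtain ⟨i, hi, rfl⟩ := List.getElem_of_mem ha
      exact ⟨i, by simp [hi]⟩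
    · obtain ⟨i, hi, rfl⟩ := List.getElem_of_mem hY
      exact ⟨i, by simp [hi]⟩
  obtain ⟨θ, hθ⟩ := h _ _ hL
  exact ⟨θ, _, _, hθ⟩

/-! ### Axiom schemes for definable predicates -/

/-- Induction for definable predicates. -/
theorem RCA0Star.induction (hM : M.RCA0Star) {P : M.Num → Prop}
    (hP : Def M fun x : Fin 1 → M.Num => P (x 0)) (zero : P M.zero)
    (succ : ∀ n, P n → P (M.add n M.one)) (n : M.Num) : P n := by
  obtain ⟨θ, V, v, h⟩ := hP.exists_formula
  have key : ∀ n, M.Sat V (push n v) θ ↔ P n := fun n => h fun _ => n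
  have := hM.sigma00_induction θ V v
  simp only [Induction, key] at this
  exact this zero succ n

/-- Induction for predicates `∃ a, R a n` with definable `R`. -/
theorem ISigma01.induction (hI : M.ISigma01) {R : M.Num → M.Num → Prop}
    (hR : Def M fun x : Fin 2 → M.Num => R (x 0) (x 1)) (zero : ∃ a, R a M.zero)
    (succ : ∀ n, (∃ a, R a n) → ∃ a, R a (M.add n M.one)) (n : M.Num) : ∃ a, R a n := by
  obtain ⟨θ, V, v, h⟩ := hR.exists_formula
  have key : ∀ n, M.SatSigma01 V (push n v) θ ↔ ∃ a, R a n :=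
    fun n => exists_congr fun a => h ![a, n]
  have := hI θ V v
  simp only [Induction, key] at this
  exact this zero succ n

/-- Definable sets belong to the model. -/
theorem RCA0Star.comprehension (hM : M.RCA0Star) {P : M.Num → Prop}
    (hP : Def M fun x : Fin 1 → M.Num => P (x 0)) : {n | P n} ∈ M.sets := by
  have hP' : Def M fun x : Fin 2 → M.Num => P (x 1) := hP.subst₁ (.var 1)
  obtain ⟨θ, V, v, h⟩ := hP'.exists_formula
  have key : ∀ a n, M.Sat V (push a (push n v)) θ ↔ P n := fun a n => h ![a, n]
  -- The formula ignores its quantified variable, so it serves as both the Σ⁰₁ and the Π⁰₁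
  -- definition.
  obtain ⟨X, hX, hXP⟩ := hM.delta01_comprehension θ θ V v fun n => by
    simp only [SatSigma01, SatPi01, key]
    exact ⟨fun ⟨_, h⟩ _ => h, fun h => ⟨M.zero, h M.zero⟩⟩
  convert hX
  ext n
  simp only [hXP, SatSigma01, key, Set.mem_ofPred_eq]
  exact ⟨fun h => ⟨M.zero, h⟩, fun ⟨_, h⟩ => h⟩

/-! ### Arithmetic and order from Σ⁰₀ induction -/

namespace RCA0Star

theorem zero_add' (hM : M.RCA0Star) (n : M.Num) : M.add M.zero n = n :=
  hM.induction (P := fun n => M.add M.zero n = n) (by repeat' constructor) (hM.add_zero _)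
    (fun n h => by rw [hM.add_succ, h]) n

theorem succ_add' (hM : M.RCA0Star) (m n : M.Num) :
    M.add (M.add m M.one) n = M.add (M.add m n) M.one :=
  hM.induction (P := fun n => M.add (M.add m M.one) n = M.add (M.add m n) M.one)
    (by repeat' constructor) (by simp only [hM.add_zero])
    (fun n h => by rw [hM.add_succ, h, hM.add_succ]) n

theorem add_comm' (hM : M.RCA0Star) (m n : M.Num) : M.add m n = M.add n m :=
  hM.induction (P := fun n => M.add m n = M.add n m) (by repeat' constructor)
    (by rw [hM.add_zero, hM.zero_add'])
    (fun n h => by rw [hM.add_succ, h, hM.succ_add']) n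

theorem add_assoc' (hM : M.RCA0Star) (m n k : M.Num) : M.add (M.add m n) k = M.add m (M.add n k) :=
  hM.induction (P := fun k => M.add (M.add m n) k = M.add m (M.add n k)) (by repeat' constructor)
    (by simp only [hM.add_zero])
    (fun k h => by simp only [hM.add_succ, h]) k

theorem zero_mul' (hM : M.RCA0Star) (n : M.Num) : M.mul M.zero n = M.zero :=
  hM.induction (P := fun n => M.mul M.zero n = M.zero) (by repeat' constructor) (hM.mul_zero _)
    (fun n h => by rw [hM.mul_succ, h, hM.add_zero]) n

theorem succ_mul' (hM : M.RCA0Star) (m n : M.Num) : M.mul (M.add m M.one) n = M.add (M.mul m n) n :=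
  hM.induction (P := fun n => M.mul (M.add m M.one) n = M.add (M.mul m n) n)
    (by repeat' constructor) (by simp only [hM.mul_zero, hM.add_zero])
    (fun n h => by
      rw [hM.mul_succ, h, hM.mul_succ, hM.add_succ, hM.add_succ, hM.add_assoc' _ m n,
        hM.add_comm' m n, ← hM.add_assoc']) n

theorem mul_comm' (hM : M.RCA0Star) (m n : M.Num) : M.mul m n = M.mul n m :=
  hM.induction (P := fun n => M.mul m n = M.mul n m) (by repeat' constructor)
    (by rw [hM.mul_zero, hM.zero_mul'])
    (fun n h => by rw [hM.mul_succ, h, hM.succ_mul']) n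

theorem mul_add' (hM : M.RCA0Star) (m n k : M.Num) :
    M.mul m (M.add n k) = M.add (M.mul m n) (M.mul m k) :=
  hM.induction (P := fun k => M.mul m (M.add n k) = M.add (M.mul m n) (M.mul m k))
    (by repeat' constructor) (by simp only [hM.mul_zero, hM.add_zero])
    (fun k h => by rw [hM.add_succ, hM.mul_succ, h, hM.mul_succ, hM.add_assoc']) k

theorem mul_assoc' (hM : M.RCA0Star) (m n k : M.Num) : M.mul (M.mul m n) k = M.mul m (M.mul n k) :=
  hM.induction (P := fun k => M.mul (M.mul m n) k = M.mul m (M.mul n k)) (by repeat' constructor)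
    (by simp only [hM.mul_zero])
    (fun k h => by simp only [hM.mul_succ, h, hM.mul_add']) k

theorem mul_one' (hM : M.RCA0Star) (m : M.Num) : M.mul m M.one = m := by
  rw [← hM.zero_add' M.one, hM.mul_succ, hM.mul_zero, hM.zero_add']

theorem lt_trans' (hM : M.RCA0Star) {a b c : M.Num} (hab : M.lt a b) (hbc : M.lt b c) : M.lt a c :=
  hM.induction (P := fun c => M.lt b c → M.lt a c)
    (by repeat' constructor) (fun h => absurd h (hM.not_lt_zero _))
    (fun c h hb => (hM.lt_succ _ _).2 <| Or.inl <| by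
      rcases (hM.lt_succ _ _).1 hb with hb | rfl
      exacts [h hb, hab]) c hbc

theorem lt_self_succ (hM : M.RCA0Star) (n : M.Num) :
    M.lt n (M.add n M.one) := (hM.lt_succ _ _).2 (Or.inr rfl)

theorem lt_irrefl' (hM : M.RCA0Star) (n : M.Num) : ¬ M.lt n n :=
  hM.induction (P := fun n => ¬ M.lt n n) (by repeat' constructor) (hM.not_lt_zero _)
    (fun n h hn => by
      rcases (hM.lt_succ _ _).1 hn with hn | hn
      · exact h (hM.lt_trans' (hM.lt_self_succ n) hn)
      · exact h (by simpa only [hn] using hM.lt_self_succ n)) n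

theorem zero_le' (hM : M.RCA0Star) (n : M.Num) : M.le M.zero n :=
  hM.induction (P := fun n => M.lt M.zero n ∨ M.zero = n) (by repeat' constructor) (Or.inr rfl)
    (fun n h => Or.inl ((hM.lt_succ _ _).2 h)) n

theorem succ_lt_succ' (hM : M.RCA0Star) {a b : M.Num} (h : M.lt a b) :
    M.lt (M.add a M.one) (M.add b M.one) :=
  hM.induction (P := fun b => M.lt a b → M.lt (M.add a M.one) (M.add b M.one))
    (by repeat' constructor) (fun h => absurd h (hM.not_lt_zero _))
    (fun b h hb => by
      rcases (hM.lt_succ _ _).1 hb with hb | rfl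
      · exact (hM.lt_succ _ _).2 (Or.inl (h hb))
      · exact hM.lt_self_succ _) b h

theorem lt_trichotomy' (hM : M.RCA0Star) (a b : M.Num) : M.lt a b ∨ a = b ∨ M.lt b a :=
  hM.induction (P := fun a => M.lt a b ∨ a = b ∨ M.lt b a) (by repeat' constructor)
    ((hM.zero_le' b).imp_right Or.inl)
    (fun a h => by
      rcases h with h | rfl | h
      · rcases (hM.lt_succ _ _).1 (hM.succ_lt_succ' h) with h | h
        exacts [Or.inl h, Or.inr (Or.inl h)]
      · exact Or.inr (Or.inr (hM.lt_self_succ _))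
      · exact Or.inr (Or.inr ((hM.lt_succ _ _).2 (Or.inl h)))) a

theorem add_lt_add_right' (hM : M.RCA0Star) {a b : M.Num} (h : M.lt a b) (c : M.Num) :
    M.lt (M.add a c) (M.add b c) :=
  hM.induction (P := fun c => M.lt (M.add a c) (M.add b c)) (by repeat' constructor)
    (by simpa only [hM.add_zero] using h)
    (fun c h => by simpa only [hM.add_succ] using hM.succ_lt_succ' h) c

theorem exists_add_of_lt (hM : M.RCA0Star) {a b : M.Num} (h : M.lt a b) : ∃ c, b = M.add a c := by
  -- The bound on c is harmless and keeps the induction predicate Σ⁰₀.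
  have := hM.induction
    (P := fun b => M.lt a b → ∃ c, M.lt c (M.add b M.one) ∧ b = M.add a c)
    (by repeat' constructor) (fun h => absurd h (hM.not_lt_zero _))
    (fun b ih hb => by
      rcases (hM.lt_succ _ _).1 hb with hb | rfl
      · obtain ⟨c, hc, h⟩ := ih hb
        exact ⟨M.add c M.one, hM.succ_lt_succ' hc, by rw [hM.add_succ, ← h]⟩
      · refine ⟨M.one, ?_, rfl⟩
        have := hM.succ_lt_succ' ((hM.lt_succ _ _).2 (hM.zero_le' a))
        rwa [hM.zero_add'] at this) b h
  obtain ⟨c, -, hc⟩ := this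
  exact ⟨c, hc⟩

theorem le_add_right' (hM : M.RCA0Star) (a c : M.Num) : M.le a (M.add a c) := by
  rcases hM.zero_le' c with h | rfl
  · left
    simpa only [hM.zero_add', hM.add_comm' c] using hM.add_lt_add_right' h a
  · right
    rw [hM.add_zero]

theorem mul_lt_mul_left' (hM : M.RCA0Star) {a b c : M.Num} (hc : M.lt M.zero c) (h : M.lt a b) :
    M.lt (M.mul c a) (M.mul c b) := by
  have hb : ∃ d, b = M.add (M.add a M.one) d := by
    rcases (hM.lt_succ _ _).1 (hM.succ_lt_succ' h) with h | h
    exacts [hM.exists_add_of_lt h, ⟨M.zero, by rw [hM.add_zero, h]⟩]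
  obtain ⟨d, rfl⟩ := hb
  rw [hM.mul_add', hM.mul_succ]
  have h₁ : M.lt (M.mul c a) (M.add (M.mul c a) c) := by
    simpa only [hM.zero_add', hM.add_comm' c] using hM.add_lt_add_right' hc (M.mul c a)
  rcases hM.le_add_right' (M.add (M.mul c a) c) (M.mul c d) with h₂ | h₂
  · exact hM.lt_trans' h₁ h₂
  · rwa [← h₂]

end RCA0Star

/-! ### The numbers of the model as an ordered semiring -/

instance : Zero M.Num := ⟨M.zero⟩

instance : One M.Num := ⟨M.one⟩

instance : Add M.Num := ⟨M.add⟩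

instance : Mul M.Num := ⟨M.mul⟩

theorem pair_def (i j : M.Num) : M.pair i j = (i + j) * (i + j) + i := rfl

section Instances

variable [hM : Fact M.RCA0Star]

/-- With the axioms held in a `Fact`, instance search finds the algebraic structure, and `ring` and
the order lemmas apply inside the model. -/
instance : CommSemiring M.Num where
  nsmul := nsmulRec
  add_assoc := hM.out.add_assoc'
  zero_add := hM.out.zero_add'
  add_zero := hM.out.add_zero
  add_comm := hM.out.add_comm'
  left_distrib := hM.out.mul_add'
  right_distrib a b c := by
    change M.mul (M.add a b) c = M.add (M.mul a c) (M.mul b c)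
    simp only [hM.out.mul_comm' _ c, hM.out.mul_add']
  zero_mul := hM.out.zero_mul'
  mul_zero := hM.out.mul_zero
  mul_assoc := hM.out.mul_assoc'
  one_mul a := (hM.out.mul_comm' _ _).trans (hM.out.mul_one' a)
  mul_one := hM.out.mul_one'
  mul_comm := hM.out.mul_comm'

noncomputable instance : LinearOrder M.Num where
  le := M.le
  lt := M.lt
  le_refl _ := Or.inr rfl
  le_trans a b c := by
    rintro (h | rfl) (h' | rfl)
    exacts [Or.inl (hM.out.lt_trans' h h'), Or.inl h, Or.inl h', Or.inr rfl]
  lt_iff_le_not_ge a b := by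
    constructor
    · intro h
      refine ⟨Or.inl h, ?_⟩
      rintro (h' | rfl)
      exacts [hM.out.lt_irrefl' _ (hM.out.lt_trans' h h'), hM.out.lt_irrefl' _ h]
    · rintro ⟨h | rfl, h'⟩
      exacts [h, absurd (Or.inr rfl) h']
  le_antisymm a b := by
    rintro (h | rfl) (h' | h')
    exacts [absurd (hM.out.lt_trans' h h') (hM.out.lt_irrefl' _), h'.symm, rfl, rfl]
  le_total a b := by
    rcases hM.out.lt_trichotomy' a b with h | rfl | h
    exacts [Or.inl (Or.inl h), Or.inl (Or.inr rfl), Or.inr (Or.inl h)]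
  toDecidableLE := Classical.decRel _

theorem lt_add_one_iff {a b : M.Num} : a < b + 1 ↔ a ≤ b := hM.out.lt_succ a b

theorem add_one_le_iff {a b : M.Num} : a + 1 ≤ b ↔ a < b := by
  have h₁ : a < a + 1 := hM.out.lt_self_succ a
  refine ⟨fun h => h₁.trans_le h, fun h => ?_⟩
  exact (hM.out.lt_succ _ _).1 (hM.out.succ_lt_succ' h)

instance : CanonicallyOrderedAdd M.Num where
  exists_add_of_le := by
    rintro a b (h | rfl)
    exacts [hM.out.exists_add_of_lt h, ⟨0, (add_zero a).symm⟩]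
  le_self_add := hM.out.le_add_right'
  le_add_self a b := by
    rw [add_comm]
    exact hM.out.le_add_right' a b

instance : IsStrictOrderedRing M.Num where
  add_le_add_left := by
    rintro a b (h | rfl) c
    exacts [Or.inl (hM.out.add_lt_add_right' h c), le_rfl]
  le_of_add_le_add_left a b c h := by
    by_contra! hlt
    have := hM.out.add_lt_add_right' hlt a
    change c + a < b + a at this
    rw [add_comm c, add_comm b] at this
    exact absurd h this.not_ge
  zero_le_one := hM.out.zero_le' _
  exists_pair_ne := ⟨0 + 1, 0, hM.out.succ_ne_zero _⟩
  mul_lt_mul_of_pos_left := fun _ hc _ _ h => hM.out.mul_lt_mul_left' hc h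
  mul_lt_mul_of_pos_right := fun c hc a b h => by
    rw [mul_comm a, mul_comm b]
    exact hM.out.mul_lt_mul_left' hc h

theorem eq_zero_or_exists_eq_add_one (a : M.Num) : a = 0 ∨ ∃ b, a = b + 1 := by
  rcases eq_or_ne a 0 with h | h
  · exact Or.inl h
  · obtain ⟨b, hb⟩ := exists_add_of_le (add_one_le_iff.2 (pos_iff_ne_zero.2 h))
    exact Or.inr ⟨b, by rw [hb]; ring⟩

theorem exp_zero (a : M.Num) : M.exp a 0 = 1 := hM.out.exp_zero a

theorem exp_add_one (a n : M.Num) : M.exp a (n + 1) = M.exp a n * a := hM.out.exp_succ a n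

theorem num_induction {P : M.Num → Prop} (hP : Def M fun x : Fin 1 → M.Num => P (x 0))
    (zero : P 0) (succ : ∀ n, P n → P (n + 1)) (n : M.Num) : P n :=
  hM.out.induction hP zero succ n

theorem exp_add (a m n : M.Num) : M.exp a (m + n) = M.exp a m * M.exp a n :=
  num_induction (P := fun n => M.exp a (m + n) = M.exp a m * M.exp a n) (by repeat' constructor)
    (by rw [exp_zero, add_zero, mul_one])
    (fun n h => by rw [← add_assoc, exp_add_one, h, exp_add_one, mul_assoc]) n

theorem exp_pos {a : M.Num} (ha : 0 < a) (n : M.Num) : 0 < M.exp a n :=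
  num_induction (P := fun n => 0 < M.exp a n) (by repeat' constructor)
    (by rw [exp_zero]; exact one_pos)
    (fun n h => by rw [exp_add_one]; exact mul_pos h ha) n

/-- The least number principle for definable predicates. -/
theorem exists_least {P : M.Num → Prop} (hP : Def M fun x : Fin 1 → M.Num => P (x 0))
    (h : ∃ n, P n) : ∃ n, P n ∧ ∀ m < n, ¬ P m := by
  by_contra! hne
  have key : ∀ n : M.Num, ∀ m, m < n → ¬ P m := by
    refine num_induction (P := fun n => ∀ m, m < n → ¬ P m) ?_ ?_ ?_
    · exact .ball (.var 0) (.not (hP.subst₁ (.var 0)))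
    · exact fun m hm => absurd hm not_lt_zero
    · intro n ih m hm hPm
      obtain ⟨l, hl, hPl⟩ := hne m hPm
      exact ih l (hl.trans_le (lt_add_one_iff.1 hm)) hPl
  obtain ⟨n, hn⟩ := h
  exact key (n + 1) n (lt_add_one n) hn

/-! ### The pairing function -/

/-- The squares of i + j and i + j + 1 differ by 2(i + j) + 1, which exceeds the summand i. Hence a
pair determines i + j, and then i. -/
theorem pair_lt_of_add_lt {i j i' j' : M.Num} (h : i + j < i' + j') :
    M.pair i j < M.pair i' j' := by
  rw [pair_def, pair_def]
  have h₁ : i + j + 1 ≤ i' + j' := add_one_le_iff.2 h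
  have h₂ : (i + j + 1) * (i + j + 1) ≤ (i' + j') * (i' + j') := mul_le_mul' h₁ h₁
  have h₃ : (i + j + 1) * (i + j + 1) = (i + j) * (i + j) + i + (i + 2 * j + 1) := by ring
  calc (i + j) * (i + j) + i < (i + j) * (i + j) + i + (i + 2 * j + 1) :=
        lt_add_of_pos_right _ (by positivity)
    _ ≤ (i' + j') * (i' + j') := h₃ ▸ h₂
    _ ≤ _ := le_self_add

theorem pair_inj {i j i' j' : M.Num} (h : M.pair i j = M.pair i' j') : i = i' ∧ j = j' := by
  rcases lt_trichotomy (i + j) (i' + j') with hlt | heq | hlt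
  · exact absurd h (pair_lt_of_add_lt hlt).ne
  · rw [pair_def, pair_def, heq] at h
    have := add_left_cancel h
    subst this
    exact ⟨rfl, add_left_cancel heq⟩
  · exact absurd h (pair_lt_of_add_lt hlt).ne'

theorem le_mul_self' (a : M.Num) : a ≤ a * a := by
  rcases eq_zero_or_exists_eq_add_one a with rfl | ⟨b, rfl⟩
  · simp
  · exact le_mul_of_one_le_left' (by simp)

theorem left_le_pair (i j : M.Num) : i ≤ M.pair i j := le_add_self

theorem right_le_pair (i j : M.Num) : j ≤ M.pair i j :=
  le_add_self.trans ((le_mul_self' (i + j)).trans le_self_add)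

theorem pair_le_pair {i j i' j' : M.Num} (hi : i ≤ i') (hj : j ≤ j') :
    M.pair i j ≤ M.pair i' j' :=
  add_le_add (mul_le_mul' (add_le_add hi hj) (add_le_add hi hj)) hi

end Instances

/-! ### `ERTAt` implies `ERT`, and `ERT` implies Σ⁰₁ induction -/

section

variable [hM : Fact M.RCA0Star]

/-- The set of codes of the pairs in a definable relation belongs to the model. -/
theorem exists_set_of_pairs {R : M.Num → M.Num → Prop}
    (hR : Def M fun x : Fin 2 → M.Num => R (x 0) (x 1)) :
    ∃ F ∈ M.sets, (∀ z ∈ F, ∃ i j, z = M.pair i j) ∧ ∀ i j, M.pair i j ∈ F ↔ R i j := by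
  -- Both entries of a pair are at most its code, so the quantifiers over them can be bounded.
  have hD : Def M fun x : Fin 1 → M.Num =>
      ∃ i, i < x 0 + 1 ∧ ∃ j, j < x 0 + 1 ∧ (x 0 = M.pair i j ∧ R i j) := by
    repeat' first | apply hR.subst₂ | constructor
  refine ⟨_, hM.out.comprehension
    (P := fun z => ∃ i, i < z + 1 ∧ ∃ j, j < z + 1 ∧ (z = M.pair i j ∧ R i j)) hD, ?_, ?_⟩
  · rintro z ⟨i, -, j, -, h, -⟩
    exact ⟨i, j, h⟩
  · intro i j
    constructor
    · rintro ⟨i', -, j', -, h, hR⟩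
      obtain ⟨rfl, rfl⟩ := pair_inj h
      exact hR
    · intro h
      exact ⟨i, lt_add_one_iff.2 (left_le_pair i j), j,
        lt_add_one_iff.2 (right_le_pair i j), rfl, h⟩

/-- Two occurrences suffice: x need not be one of them, but at least one of them differs from x. -/
theorem ERT_of_forall_ERTAt (h : ∀ j, M.ERTAt j) : M.ERT := by
  intro k F hF hfun
  obtain ⟨b, hb⟩ := h (1 + 1) k F hF hfun
  refine ⟨b, fun x hx => ?_⟩
  obtain ⟨G, -, hG, hmono, hval⟩ := hb x hx
  have h01 : (0 : M.Num) < 1 := one_pos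
  have h12 : (1 : M.Num) < 1 + 1 := lt_add_one 1
  obtain ⟨y₀, hy₀, -⟩ := hG.2 0 (h01.trans h12)
  obtain ⟨y₁, hy₁, -⟩ := hG.2 1 h12
  have hlt : y₀ < y₁ := hmono 0 1 y₀ y₁ h01 hy₀ hy₁
  by_cases hxy : x = y₀
  · exact ⟨y₁, (hval _ _ hy₁).1, fun h => hlt.ne (hxy.symm.trans h), (hval _ _ hy₁).2⟩
  · exact ⟨y₀, (hval _ _ hy₀).1, hxy, (hval _ _ hy₀).2⟩

/-- A `Σ⁰₁` definable proper initial segment without largest element yields a coloring in which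
arbitrarily late some color occurs for the only time. -/
theorem not_ERT_of_failure {T : M.Num → M.Num → Prop}
    (hT : Def M fun x : Fin 2 → M.Num => T (x 0) (x 1)) (zero : ∃ x, T 0 x)
    (succ : ∀ n, (∃ x, T n x) → ∃ x, T (n + 1) x) {a : M.Num} (ha : ¬ ∃ x, T a x) : ¬ M.ERT := by
  intro hE
  -- H s n: n is verified by stage s.
  let H : M.Num → M.Num → Prop := fun s n => ∀ m, m < n + 1 → ∃ x, x < s ∧ T m x
  have hH : Def M fun x : Fin 2 → M.Num => H (x 0) (x 1) := by
    repeat' first | apply hT.subst₂ | constructor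
  have H_mono : ∀ {s s' n}, s ≤ s' → H s n → H s' n := fun hs h m hm =>
    let ⟨x, hx, hTx⟩ := h m hm
    ⟨x, hx.trans_le hs, hTx⟩
  have H_zero : ∃ s, H s 0 := by
    obtain ⟨x, hx⟩ := zero
    refine ⟨x + 1, fun m hm => ⟨x, lt_add_one x, ?_⟩⟩
    rwa [le_zero_iff.1 (lt_add_one_iff.1 hm)]
  have H_succ : ∀ n, (∃ s, H s n) → ∃ s, H s (n + 1) := by
    rintro n ⟨s, hs⟩
    obtain ⟨x₀, -, hx₀⟩ := hs n (lt_add_one n)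
    obtain ⟨x, hx⟩ := succ n ⟨x₀, hx₀⟩
    refine ⟨max s (x + 1), fun m hm => ?_⟩
    rcases (lt_add_one_iff.1 hm).lt_or_eq with hm | rfl
    · exact H_mono (le_max_left _ _) hs m hm
    · exact ⟨x, (lt_add_one x).trans_le (le_max_right _ _), hx⟩
  have H_not : ∀ s, ¬ H s a := fun s hs =>
    let ⟨x, _, hx⟩ := hs a (lt_add_one a)
    ha ⟨x, hx⟩
  -- J s n: n becomes verified in passing from s to s + 1. By monotonicity of H this happens for at
  -- most one s.
  let J : M.Num → M.Num → Prop := fun s n => ¬ H s n ∧ H (s + 1) n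
  have hJ : Def M fun x : Fin 2 → M.Num => J (x 0) (x 1) := by
    refine .and (.not (hH.subst₂ (.var 0) (.var 1))) (hH.subst₂ (.add (.var 0) (.const 1)) (.var 1))
  have J_inj : ∀ {s s' n}, J s n → J s' n → s = s' := by
    intro s s' n h h'
    rcases lt_trichotomy s s' with hlt | rfl | hlt
    · exact absurd (H_mono (add_one_le_iff.2 hlt) h.2) h'.1
    · rfl
    · exact absurd (H_mono (add_one_le_iff.2 hlt) h'.2) h.1
  -- Several n may become verified at once; the least is the color. The color a + 1 marks stages
  -- where nothing happens.
  let Col : M.Num → M.Num → Prop := fun s n =>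
    (n < a + 1 ∧ J s n ∧ ∀ n', n' < n → ¬ J s n') ∨ (n = a + 1 ∧ ∀ n', n' < a + 1 → ¬ J s n')
  have hCol : Def M fun x : Fin 2 → M.Num => Col (x 0) (x 1) := by
    repeat' first | apply hJ.subst₂ | constructor
  obtain ⟨F, hF, hFpair, hFC⟩ := exists_set_of_pairs hCol
  have hfun : M.IsFun F Set.univ (M.below (a + 1 + 1)) := by
    constructor
    · intro z hz
      obtain ⟨i, j, rfl⟩ := hFpair z hz
      refine ⟨i, trivial, j, ?_, rfl⟩
      rcases (hFC i j).1 hz with ⟨h, -⟩ | ⟨rfl, -⟩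
      · exact h.trans (lt_add_one _)
      · exact lt_add_one (a + 1)
    · intro s _
      simp only [hFC]
      by_cases h : ∃ n, n < a + 1 ∧ J s n
      · obtain ⟨n, ⟨hna, hn⟩, hmin⟩ := exists_least (P := fun n => n < a + 1 ∧ J s n)
          (by repeat' first | apply hJ.subst₂ | constructor) h
        refine ⟨n, Or.inl ⟨hna, hn, fun n' hn' hJ' => hmin n' hn' ⟨hn'.trans hna, hJ'⟩⟩, ?_⟩
        rintro n' (⟨-, hJ', hmin'⟩ | ⟨-, hn'⟩)
        · rcases lt_trichotomy n n' with hlt | rfl | hlt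
          · exact absurd hn (hmin' n hlt)
          · rfl
          · exact absurd ⟨hlt.trans hna, hJ'⟩ (hmin n' hlt)
        · exact absurd hn (hn' n hna)
      · push Not at h
        refine ⟨a + 1, Or.inr ⟨rfl, h⟩, ?_⟩
        rintro n' (⟨hn', hJ', -⟩ | ⟨rfl, -⟩)
        · exact absurd hJ' (h n' hn')
        · rfl
  obtain ⟨b, hb⟩ := hE _ F hF hfun
  -- The first n not verified by b becomes verified later, since its predecessor already is. The
  -- stage x at which this happens is at or after b and does not have color a + 1, so its color is
  -- unrepeated.
  obtain ⟨n, hn, hnmin⟩ := exists_least (P := fun n => ¬ H b n)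
    (.not (hH.subst₂ (.const b) (.var 0))) ⟨a, H_not b⟩
  have hna : n ≤ a := not_lt.1 fun h => hnmin a h (H_not b)
  have hex : ∃ s, H s n := by
    rcases eq_zero_or_exists_eq_add_one n with rfl | ⟨m, rfl⟩
    · exact H_zero
    · exact H_succ m ⟨b, not_not.1 (hnmin m (lt_add_one m))⟩
  obtain ⟨s, hs, hsmin⟩ := exists_least (P := fun s => H s n)
    (hH.subst₂ (.var 0) (.const n)) hex
  have hbs : b < s := not_le.1 fun h => hn (H_mono h hs)
  obtain ⟨x, rfl⟩ : ∃ x, s = x + 1 :=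
    (eq_zero_or_exists_eq_add_one s).resolve_left (zero_le.trans_lt hbs).ne'
  have hJx : J x n := ⟨hsmin x (lt_add_one x), hs⟩
  obtain ⟨y, -, hxy, c, hxc, hyc⟩ := hb x (lt_add_one_iff.1 hbs)
  rw [hFC] at hxc hyc
  rcases hxc with ⟨hc, hJc, -⟩ | ⟨-, hc⟩
  · rcases hyc with ⟨-, hJc', -⟩ | ⟨rfl, -⟩
    · exact hxy (J_inj hJc hJc')
    · exact lt_irrefl _ hc
  · exact hc n (lt_add_one_iff.2 hna) hJx

theorem ISigma01_of_ERT (hE : M.ERT) : M.ISigma01 := by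
  intro θ V v zero succ n
  by_contra ha
  have hT : Def M fun x : Fin 2 → M.Num => M.Sat V (push (x 1) (push (x 0) v)) θ := by
    refine Def.sat V θ fun i => ?_
    match i with
    | 0 => exact .var 1
    | 1 => exact .var 0
    | i + 2 => exact .const (v i)
  exact not_ERT_of_failure (T := fun m x => M.Sat V (push x (push m v)) θ) hT zero succ ha hE

end

/-! ### Digit expansions and codes of sequences -/

/-- `d` is the digit with index `i` in the base `B` expansion of `n`. -/
def Digit (B n i d : M.Num) : Prop :=
  M.lt d B ∧ ∃ q, M.lt q (n + 1) ∧ ∃ r, M.lt r (M.exp B i) ∧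
    n = (q * B + d) * M.exp B i + r

theorem Def.digit {n : ℕ} {B p i d : (Fin n → M.Num) → M.Num} (hB : IsTerm M B)
    (hp : IsTerm M p) (hi : IsTerm M i) (hd : IsTerm M d) :
    Def M fun x => Digit (B x) (p x) (i x) (d x) := by
  have h : Def M fun x : Fin 4 → M.Num => Digit (x 0) (x 1) (x 2) (x 3) := by
    repeat' constructor
  exact h.subst₄ hB hp hi hd

section

variable [hM : Fact M.RCA0Star]

theorem exists_div {d : M.Num} (hd : 0 < d) (n : M.Num) : ∃ q r, r < d ∧ n = q * d + r := by
  have h : ∃ q, q < n + 1 ∧ ∃ r, r < d ∧ n = q * d + r := by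
    refine num_induction (P := fun n => ∃ q, q < n + 1 ∧ ∃ r, r < d ∧ n = q * d + r) ?_ ?_ ?_ n
    · repeat' constructor
    · exact ⟨0, lt_add_one 0, 0, hd, by simp⟩
    · rintro n ⟨q, hq, r, hr, h⟩
      rcases (add_one_le_iff.2 hr).lt_or_eq with hr' | hr'
      · exact ⟨q, hq.trans (lt_add_one _), r + 1, hr', by rw [h, add_assoc]⟩
      · exact ⟨q + 1, by simpa using hq, 0, hd, by rw [h, ← hr']; ring⟩
  obtain ⟨q, -, r, h⟩ := h
  exact ⟨q, r, h⟩

theorem div_unique {d q r q' r' : M.Num} (hr : r < d) (hr' : r' < d)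
    (h : q * d + r = q' * d + r') : q = q' ∧ r = r' := by
  have key : ∀ {q r q' r' : M.Num}, r < d → q * d + r = q' * d + r' → q' ≤ q := by
    intro q r q' r' hr h
    by_contra! hlt
    have h₁ : (q + 1) * d ≤ q' * d := mul_le_mul_left (add_one_le_iff.2 hlt) d
    have h₂ : q * d + r < (q + 1) * d := by
      rw [add_mul, one_mul]
      exact add_lt_add_right hr _
    exact absurd (h₂.trans_le (h₁.trans le_self_add)) h.not_lt
  obtain rfl : q = q' := le_antisymm (key hr' h.symm) (key hr h)
  exact ⟨rfl, add_left_cancel h⟩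

theorem Digit.lt {B n i d : M.Num} (h : Digit B n i d) : d < B := h.1

theorem Digit.of_eq {B n i d q r : M.Num} (hd : d < B) (hr : r < M.exp B i)
    (h : n = (q * B + d) * M.exp B i + r) : Digit B n i d := by
  have hB : 0 < B := zero_le.trans_lt hd
  refine ⟨hd, q, lt_add_one_iff.2 ?_, r, hr, h⟩
  have h₁ : (1 : M.Num) ≤ B := by simpa using add_one_le_iff.2 hB
  have h₂ : (1 : M.Num) ≤ M.exp B i := by simpa using add_one_le_iff.2 (exp_pos hB i)
  calc q ≤ q * B := le_mul_of_one_le_right' h₁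
    _ ≤ q * B + d := le_self_add
    _ ≤ (q * B + d) * M.exp B i := le_mul_of_one_le_right' h₂
    _ ≤ n := h ▸ le_self_add

theorem Digit.unique {B n i d d' : M.Num} (h : Digit B n i d) (h' : Digit B n i d') : d = d' := by
  obtain ⟨hd, q, -, r, hr, h⟩ := h
  obtain ⟨hd', q', -, r', hr', h'⟩ := h'
  exact (div_unique hd hd' (div_unique hr hr' (h.symm.trans h')).1).2

theorem exists_digit {B : M.Num} (hB : 0 < B) (n i : M.Num) : ∃ d, Digit B n i d := by
  obtain ⟨p, r, hr, rfl⟩ := exists_div (exp_pos hB i) n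
  obtain ⟨q, d, hd, rfl⟩ := exists_div hB p
  exact ⟨d, .of_eq hd hr rfl⟩

theorem digit_of_lt_exp {B n i : M.Num} (hB : 0 < B) (hn : n < M.exp B i) : Digit B n i 0 :=
  .of_eq (q := 0) hB hn (by simp)

theorem exists_eq_add_one_add {a b : M.Num} (h : a < b) : ∃ c, b = a + 1 + c :=
  exists_add_of_le (add_one_le_iff.2 h)

theorem digit_add_self {B n i d e : M.Num} (h : Digit B n i d) (he : d + e < B) :
    Digit B (n + e * M.exp B i) i (d + e) := by
  obtain ⟨-, q, -, r, hr, rfl⟩ := h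
  exact .of_eq (q := q) he hr (by ring)

theorem mul_add_lt_mul {a b c d : M.Num} (ha : a < b) (hc : c < d) : a * d + c < b * d := by
  calc a * d + c < a * d + d := by simpa using hc
    _ = (a + 1) * d := by ring
    _ ≤ b * d := mul_le_mul_left (add_one_le_iff.2 ha) d

/-- Since d + e < B, raising the digit at i causes no carry. -/
theorem digit_add_of_ne {B n i l d e x : M.Num} (h : Digit B n i d) (he : d + e < B) (hl : l ≠ i)
    (hx : Digit B n l x) : Digit B (n + e * M.exp B i) l x := by
  have hB : 0 < B := zero_le.trans_lt he
  rcases hl.lt_or_gt with hlt | hlt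
  · obtain ⟨c, rfl⟩ := exists_eq_add_one_add hlt
    obtain ⟨hx, q, -, r, hr, rfl⟩ := hx
    refine .of_eq (q := q + e * M.exp B c) hx hr ?_
    rw [exp_add, exp_add_one]
    ring
  · obtain ⟨c, rfl⟩ := exists_eq_add_one_add hlt
    obtain ⟨hd, q, -, r, hr, rfl⟩ := h
    obtain ⟨p, R, hR, rfl⟩ := exists_div (exp_pos hB c) q
    obtain ⟨q, y, hy, rfl⟩ := exists_div hB p
    -- Whatever the digit at i, the part of the number below position l stays below B^l, so the
    -- digit at l is read off the same quotient.
    have aux : ∀ d, d < B → ((R * B + d) * M.exp B i + r) < M.exp B (i + 1 + c) := by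
      intro d hd
      rw [exp_add, exp_add_one, show M.exp B i * B * M.exp B c = M.exp B c * B * M.exp B i by ring]
      exact mul_add_lt_mul (mul_add_lt_mul hR hd) hr
    have hy' : Digit B ((((q * B + y) * M.exp B c + R) * B + d) * M.exp B i + r) (i + 1 + c) y := by
      refine .of_eq (q := q) hy (aux d hd) ?_
      rw [exp_add, exp_add_one]
      ring
    rw [hx.unique hy']
    refine .of_eq (q := q) hy (aux (d + e) he) ?_
    rw [exp_add, exp_add_one]
    ring

theorem add_lt_exp {B n i m d e : M.Num} (h : Digit B n i d) (he : d + e < B) (hi : i < m)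
    (hn : n < M.exp B m) : n + e * M.exp B i < M.exp B m := by
  obtain ⟨c, rfl⟩ := exists_eq_add_one_add hi
  obtain ⟨hd, q, -, r, hr, rfl⟩ := h
  have hE : M.exp B (i + 1 + c) = M.exp B c * B * M.exp B i := by
    rw [exp_add, exp_add_one]
    ring
  rw [hE] at hn ⊢
  have hq : q < M.exp B c := by
    by_contra! hq
    refine absurd hn (not_lt.2 ?_)
    calc M.exp B c * B * M.exp B i ≤ q * B * M.exp B i :=
          mul_le_mul_left (mul_le_mul_left hq _) _
      _ ≤ (q * B + d) * M.exp B i := mul_le_mul_left le_self_add _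
      _ ≤ _ := le_self_add
  rw [show (q * B + d) * M.exp B i + r + e * M.exp B i = (q * B + (d + e)) * M.exp B i + r by ring]
  exact mul_add_lt_mul (mul_add_lt_mul hq he) hr

/-- Appending a leading digit. -/
theorem append_digit {B n m e : M.Num} (he : e < B) (hn : n < M.exp B m) :
    n + e * M.exp B m < M.exp B (m + 1) ∧ Digit B (n + e * M.exp B m) m e ∧
      ∀ i < m, ∀ x, Digit B n i x → Digit B (n + e * M.exp B m) i x := by
  have hB : 0 < B := zero_le.trans_lt he
  have h0 := digit_of_lt_exp hB hn
  have he' : 0 + e < B := by rwa [zero_add]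
  refine ⟨?_, by simpa using digit_add_self h0 he', fun i hi x hx =>
    digit_add_of_ne h0 he' hi.ne hx⟩
  rw [exp_add_one, add_comm, mul_comm (M.exp B m)]
  exact mul_add_lt_mul he hn

/-- Definable sequences of bounded length with bounded values are coded by numbers. -/
theorem exists_code {h : M.Num → M.Num → Prop} (hh : Def M fun x : Fin 2 → M.Num => h (x 0) (x 1))
    {B : M.Num} (m : M.Num) (htot : ∀ i < m, ∃ d < B, h i d) :
    ∃ n < M.exp B m, ∀ i < m, ∃ d < B, Digit B n i d ∧ h i d := by
  -- Exponentiation supplies the bound B^l on the code, which makes the statement Σ⁰₀.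
  have key : ∀ l : M.Num, l < m + 1 →
      ∃ n, n < M.exp B l ∧ ∀ i, i < l → ∃ d, d < B ∧ Digit B n i d ∧ h i d := by
    refine num_induction (P := fun l => l < m + 1 →
      ∃ n, n < M.exp B l ∧ ∀ i, i < l → ∃ d, d < B ∧ Digit B n i d ∧ h i d) ?_ ?_ ?_
    · repeat' first | apply Def.digit | apply hh.subst₂ | constructor
    · intro _
      exact ⟨0, by rw [exp_zero]; exact one_pos, fun i hi => absurd hi not_lt_zero⟩
    · intro l ih hl
      have hlm : l < m := by simpa using hl
      obtain ⟨n, hn, hdig⟩ := ih (hlm.trans (lt_add_one m))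
      obtain ⟨e, he, hle⟩ := htot l hlm
      obtain ⟨h₁, h₂, h₃⟩ := append_digit he hn
      refine ⟨_, h₁, fun i hi => ?_⟩
      rcases (lt_add_one_iff.1 hi).lt_or_eq with hi | rfl
      · obtain ⟨d, hd, hD, hid⟩ := hdig i hi
        exact ⟨d, hd, h₃ i hi d hD, hid⟩
      · exact ⟨e, he, h₂, hle⟩
  exact key m (lt_add_one m)

/-! ### Strong collection -/

/-- Strong `Σ⁰₁` collection: below any bound, all existing witnesses are bounded. -/
theorem ISigma01.strong_collection (hI : M.ISigma01) {R : M.Num → M.Num → Prop}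
    (hR : Def M fun x : Fin 2 → M.Num => R (x 0) (x 1)) (m : M.Num) :
    ∃ t, ∀ i < m, ∀ s, R i s → ∃ s' < t, R i s' := by
  -- Q t n: some p ≥ n below 2^m codes, by its binary digits, a set of indices that all have
  -- witnesses below t. If no t were a bound for all indices, the set could always be enlarged, so
  -- Σ⁰₁ induction on n would reach n = 2^m, which is absurd.
  let Q : M.Num → M.Num → Prop := fun t n => ∃ p, p < M.exp (1 + 1) m ∧ (n < p + 1 ∧
    ∀ i, i < m → Digit (1 + 1) p i 1 → ∃ s, s < t ∧ R i s)
  have hQ : Def M fun x : Fin 2 → M.Num => Q (x 0) (x 1) := by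
    repeat' first | apply Def.digit | apply hR.subst₂ | constructor
  have h2 : (1 : M.Num) < 1 + 1 := lt_add_one 1
  have h2' : (0 : M.Num) < 1 + 1 := one_pos.trans h2
  by_contra! hne
  suffices h : ∀ n, ∃ t, Q t n by
    obtain ⟨t, p, hp, hnp, -⟩ := h (M.exp (1 + 1) m)
    exact absurd (lt_add_one_iff.1 hnp) hp.not_ge
  refine hI.induction hQ ?_ ?_
  · refine ⟨0, 0, exp_pos h2' m, lt_add_one 0, fun i _ hi => ?_⟩
    exact absurd (hi.unique (digit_of_lt_exp h2' (exp_pos h2' i))) one_ne_zero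
  · rintro n ⟨t, p, hp, hnp, ht⟩
    -- This index has a witness but none below t, so its digit in p is 0. Turning it into 1 adds 2^i
    -- ≥ 1 to the code.
    obtain ⟨i, hi, s, hs, hno⟩ := hne t
    have h0 : Digit (1 + 1) p i 0 := by
      obtain ⟨d, hd⟩ := exists_digit h2' p i
      rcases (lt_add_one_iff.1 hd.lt).lt_or_eq with h | rfl
      · rw [← zero_add (1 : M.Num)] at h
        rwa [← le_zero_iff.1 (lt_add_one_iff.1 h)]
      · obtain ⟨s', hs', hR'⟩ := ht i hi hd
        exact absurd hR' (hno s' hs')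
    have he : (0 : M.Num) + 1 < 1 + 1 := by rwa [zero_add]
    refine ⟨max t (s + 1), _, add_lt_exp h0 he hi hp, ?_, fun l hl hdl => ?_⟩
    · change n + 1 < _
      have h1 : (1 : M.Num) ≤ M.exp (1 + 1) i := by simpa using add_one_le_iff.2 (exp_pos h2' i)
      rw [one_mul]
      exact add_lt_add_left (hnp.trans_le (add_le_add_right h1 p)) 1
    · by_cases hli : l = i
      · subst hli
        exact ⟨s, (lt_add_one s).trans_le (le_max_right _ _), hs⟩
      · obtain ⟨x, hx⟩ := exists_digit h2' p l
        obtain rfl := hdl.unique (digit_add_of_ne h0 he hli hx)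
        obtain ⟨s', hs', hR'⟩ := ht l hl hx
        exact ⟨s', hs'.trans_le (le_max_left _ _), hR'⟩

end

/-! ### Definable counting -/

/-- The base `B` digits of `σ` with indices up to `s` are the numbers of elements of `{y | A c y}`
below `0, …, s`. -/
def Run (A : M.Num → M.Num → Prop) (σ B c s : M.Num) : Prop :=
  Digit B σ 0 0 ∧ ∀ y, M.lt y s → ∀ m, M.lt m B → Digit B σ y m →
    (A c y → Digit B σ (y + 1) (m + 1)) ∧ (¬ A c y → Digit B σ (y + 1) m)

theorem Def.run {A : M.Num → M.Num → Prop} (hA : Def M fun x : Fin 2 → M.Num => A (x 0) (x 1))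
    {n : ℕ} {σ B c s : (Fin n → M.Num) → M.Num} (hσ : IsTerm M σ) (hB : IsTerm M B)
    (hc : IsTerm M c) (hs : IsTerm M s) : Def M fun x => Run A (σ x) (B x) (c x) (s x) := by
  have h : Def M fun x : Fin 4 → M.Num => Run A (x 0) (x 1) (x 2) (x 3) := by
    refine .and (.digit (.var 1) (.var 0) (.const 0) (.const 0)) ?_
    repeat' first | apply Def.digit | apply hA.subst₂ | constructor
  exact h.subst₄ hσ hB hc hs

/-- The set `{y | A c y}` has exactly `m` elements below `s`. -/
def Count (A : M.Num → M.Num → Prop) (c s m : M.Num) : Prop :=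
  ∃ σ, M.lt σ (M.exp (s + 1) (s + 1)) ∧ (Run A σ (s + 1) c s ∧ Digit (s + 1) σ s m)

theorem Def.count {A : M.Num → M.Num → Prop}
    (hA : Def M fun x : Fin 2 → M.Num => A (x 0) (x 1)) :
    Def M fun x : Fin 3 → M.Num => Count A (x 0) (x 1) (x 2) := by
  repeat' first | apply Def.digit | apply Def.run hA | constructor

section

variable [hM : Fact M.RCA0Star] {A : M.Num → M.Num → Prop}

/-- The running count at s is at most s < B, so it always fits into one digit. The base stays fixed
while the run is extended. -/
theorem exists_run (hA : Def M fun x : Fin 2 → M.Num => A (x 0) (x 1)) {B : M.Num} (c s : M.Num)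
    (hs : s < B) :
    ∃ σ, σ < M.exp B (s + 1) ∧ (Run A σ B c s ∧ ∃ m, m < s + 1 ∧ Digit B σ s m) := by
  revert s
  refine num_induction (P := fun s => s < B →
    ∃ σ, σ < M.exp B (s + 1) ∧ (Run A σ B c s ∧ ∃ m, m < s + 1 ∧ Digit B σ s m)) ?_ ?_ ?_
  · repeat' first | apply Def.digit | apply Def.run hA | constructor
  · intro hB
    have h0 : Digit B 0 0 0 := digit_of_lt_exp hB (exp_pos hB 0)
    exact ⟨0, exp_pos hB _, ⟨h0, fun y hy => absurd hy (hM.out.not_lt_zero y)⟩, 0, lt_add_one 0, h0⟩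
  · intro s ih hs
    have hB : 0 < B := zero_le.trans_lt hs
    obtain ⟨σ, hσ, hrun, m, hm, hdig⟩ := ih ((lt_add_one s).trans hs)
    obtain ⟨e, hes, hAe, hAe'⟩ : ∃ e, e < s + 1 + 1 ∧ (A c s → e = m + 1) ∧ (¬ A c s → e = m) := by
      by_cases h : A c s
      · exact ⟨m + 1, add_lt_add_left hm 1, fun _ => rfl, fun h' => absurd h h'⟩
      · exact ⟨m, hm.trans (lt_add_one _), fun h' => absurd h' h, fun _ => rfl⟩
    have he : e < B := (lt_add_one_iff.1 hes).trans_lt hs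
    obtain ⟨h₁, h₂, h₃⟩ := append_digit he hσ
    -- The condition in `Run` speaks of the digits of the new code; by uniqueness the old positions
    -- carry the old digits.
    have hback : ∀ y < s + 1, ∀ x, Digit B (σ + e * M.exp B (s + 1)) y x → Digit B σ y x := by
      intro y hy x hx
      obtain ⟨x', hx'⟩ := exists_digit hB σ y
      rwa [hx.unique (h₃ y hy x' hx')]
    refine ⟨_, h₁, ⟨h₃ 0 (zero_le.trans_lt (lt_add_one s)) 0 hrun.1, fun y hy x hxB hx => ?_⟩,
      e, hes, h₂⟩
    have hx' := hback y hy x hx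
    rcases (lt_add_one_iff.1 hy).lt_or_eq with hlt | rfl
    · obtain ⟨h₄, h₅⟩ := hrun.2 y hlt x hxB hx'
      have hy' : y + 1 < s + 1 := add_lt_add_left hlt 1
      exact ⟨fun h => h₃ _ hy' _ (h₄ h), fun h => h₃ _ hy' _ (h₅ h)⟩
    · obtain rfl := hdig.unique hx'
      exact ⟨fun h => hAe h ▸ h₂, fun h => hAe' h ▸ h₂⟩

/-- The bases may differ because `Count` uses base s + 1, which changes with s; this comparison
links successive counts. -/
theorem Run.unique {σ B σ' B' c s s' y m m' : M.Num}
    (h : Run A σ B c s) (h' : Run A σ' B' c s') (hy : y ≤ s) (hy' : y ≤ s') (hm : Digit B σ y m)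
    (hm' : Digit B' σ' y m') : m = m' := by
  have hB : 0 < B := zero_le.trans_lt hm.lt
  have hB' : 0 < B' := zero_le.trans_lt hm'.lt
  have key : ∀ y : M.Num, y < s + 1 → y < s' + 1 → ∀ m, m < B → ∀ m', m' < B' →
      Digit B σ y m → Digit B' σ' y m' → m = m' := by
    refine num_induction (P := fun y => y < s + 1 → y < s' + 1 → ∀ m, m < B → ∀ m', m' < B' →
      Digit B σ y m → Digit B' σ' y m' → m = m') ?_ ?_ ?_
    · repeat' first | apply Def.digit | constructor
    · intro _ _ m _ m' _ hm hm'
      rw [hm.unique h.1, hm'.unique h'.1]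
    · intro y ih hy hy' m _ m' _ hm hm'
      have hys : y < s := by simpa using hy
      have hys' : y < s' := by simpa using hy'
      obtain ⟨x, hx⟩ := exists_digit hB σ y
      obtain ⟨x', hx'⟩ := exists_digit hB' σ' y
      obtain rfl := ih (hys.trans (lt_add_one s)) (hys'.trans (lt_add_one s')) x hx.lt x' hx'.lt
        hx hx'
      obtain ⟨h₁, h₂⟩ := h.2 y hys x hx.lt hx
      obtain ⟨h₁', h₂'⟩ := h'.2 y hys' x hx'.lt hx'
      by_cases hAy : A c y
      · rw [hm.unique (h₁ hAy), hm'.unique (h₁' hAy)]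
      · rw [hm.unique (h₂ hAy), hm'.unique (h₂' hAy)]
  exact key y (lt_add_one_iff.2 hy) (lt_add_one_iff.2 hy') m hm.lt m' hm'.lt hm hm'

theorem Count.unique {c s m m' : M.Num} (h : Count A c s m) (h' : Count A c s m') : m = m' := by
  obtain ⟨σ, -, hσ, hm⟩ := h
  obtain ⟨σ', -, hσ', hm'⟩ := h'
  exact hσ.unique hσ' le_rfl le_rfl hm hm'

theorem exists_count (hA : Def M fun x : Fin 2 → M.Num => A (x 0) (x 1)) (c s : M.Num) :
    ∃ m, m ≤ s ∧ Count A c s m := by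
  obtain ⟨σ, hσ, hrun, m, hm, hdig⟩ := exists_run hA c s (lt_add_one s)
  exact ⟨m, lt_add_one_iff.1 hm, σ, hσ, hrun, hdig⟩

theorem count_zero (hA : Def M fun x : Fin 2 → M.Num => A (x 0) (x 1)) (c : M.Num) :
    Count A c 0 0 := by
  obtain ⟨m, hm, h⟩ := exists_count hA c 0
  rwa [le_zero_iff.1 hm] at h

theorem Count.succ (hA : Def M fun x : Fin 2 → M.Num => A (x 0) (x 1)) {c s m : M.Num}
    (h : Count A c s m) :
    (A c s → Count A c (s + 1) (m + 1)) ∧ (¬ A c s → Count A c (s + 1) m) := by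
  obtain ⟨σ, -, hrun, hm⟩ := h
  obtain ⟨σ', hσ', hrun', -⟩ := exists_run hA c (s + 1) (lt_add_one (s + 1))
  obtain ⟨x, hx⟩ := exists_digit (zero_le.trans_lt (lt_add_one (s + 1))) σ' s
  obtain rfl := hrun.unique hrun' le_rfl (lt_add_one s).le hm hx
  obtain ⟨h₁, h₂⟩ := hrun'.2 s (lt_add_one s) m hx.lt hx
  exact ⟨fun h => ⟨σ', hσ', hrun', h₁ h⟩, fun h => ⟨σ', hσ', hrun', h₂ h⟩⟩

/-- A definable counting function for the sets `{y | A c y}`. -/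
theorem exists_counting_function (hA : Def M fun x : Fin 2 → M.Num => A (x 0) (x 1)) :
    ∃ N : M.Num → M.Num → M.Num, (Def M fun x : Fin 3 → M.Num => N (x 0) (x 1) = x 2) ∧
      (∀ c, N c 0 = 0) ∧ (∀ c s, N c s ≤ s) ∧ (∀ c s, A c s → N c (s + 1) = N c s + 1) ∧
      ∀ c s, ¬ A c s → N c (s + 1) = N c s := by
  -- N is chosen outside the model, but by uniqueness its graph is `Count`, which is Σ⁰₀.
  choose N hN hC using exists_count hA
  have hiff : ∀ c s m, N c s = m ↔ Count A c s m := fun c s m =>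
    ⟨fun h => h ▸ hC c s, fun h => (hC c s).unique h⟩
  refine ⟨N, by simpa only [hiff] using Def.count hA, fun c => (hiff _ _ _).2 (count_zero hA c), hN,
    fun c s h => (hiff _ _ _).2 (((hC c s).succ hA).1 h),
    fun c s h => (hiff _ _ _).2 (((hC c s).succ hA).2 h)⟩

theorem count_mono {N : M.Num → M.Num → M.Num}
    (hN : Def M fun x : Fin 3 → M.Num => N (x 0) (x 1) = x 2)
    (hsucc : ∀ c s, A c s → N c (s + 1) = N c s + 1)
    (hsame : ∀ c s, ¬ A c s → N c (s + 1) = N c s)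
    (c : M.Num) {s t : M.Num} (h : s ≤ t) : N c s ≤ N c t := by
  obtain ⟨d, rfl⟩ := exists_add_of_le h
  by_contra! hlt
  -- N is not a term, only its graph is definable; N c s ≤ N c (s + d) is therefore phrased as a
  -- bounded statement about the graph.
  refine num_induction (P := fun d => ∀ m, m < N c s → ¬ N c (s + d) = m) ?_ ?_ ?_ d _ hlt rfl
  · repeat' first | apply hN.subst₃ (P := fun c s m => N c s = m) | constructor
  · intro m hm h
    rw [add_zero] at h
    exact hm.ne' h
  · intro d ih m hm h
    rw [← add_assoc] at h
    have hle : N c (s + d) ≤ N c (s + d + 1) := by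
      by_cases hA : A c (s + d)
      · exact (hsucc _ _ hA).symm ▸ le_self_add
      · exact (hsame _ _ hA).ge
    exact ih _ (hle.trans_lt (h ▸ hm)) rfl

theorem count_lt {N : M.Num → M.Num → M.Num}
    (hN : Def M fun x : Fin 3 → M.Num => N (x 0) (x 1) = x 2)
    (hsucc : ∀ c s, A c s → N c (s + 1) = N c s + 1)
    (hsame : ∀ c s, ¬ A c s → N c (s + 1) = N c s)
    (c : M.Num) {s t : M.Num} (h : s < t) (hs : A c s) : N c s < N c t :=
  calc N c s < N c s + 1 := lt_add_one _
    _ = N c (s + 1) := (hsucc c s hs).symm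
    _ ≤ N c t := count_mono hN hsucc hsame c (add_one_le_iff.2 h)

/-- Between `b` and `t` there is an element with each index from `N c b` on and below `N c t`. -/
theorem exists_count_eq {N : M.Num → M.Num → M.Num}
    (hN : Def M fun x : Fin 3 → M.Num => N (x 0) (x 1) = x 2)
    (hsucc : ∀ c s, A c s → N c (s + 1) = N c s + 1)
    (hsame : ∀ c s, ¬ A c s → N c (s + 1) = N c s)
    (hzero : ∀ c, N c 0 = 0) (c : M.Num) {b t m : M.Num} (hb : N c b ≤ m)
    (ht : m < N c t) : ∃ y, b ≤ y ∧ y < t ∧ A c y ∧ N c y = m := by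
  -- The predicate says m < N c s through the graph. The predecessor of the least such s is the
  -- element sought.
  obtain ⟨s, hs, hmin⟩ := exists_least (P := fun s => ∀ l, l < m + 1 → ¬ N c s = l)
    (by repeat' first | apply hN.subst₃ (P := fun c s m => N c s = m) | constructor)
    ⟨t, fun l hl h => (lt_add_one_iff.1 hl).not_gt (h ▸ ht)⟩
  have hs' : m < N c s := not_le.1 fun h => hs _ (lt_add_one_iff.2 h) rfl
  obtain ⟨y, rfl⟩ : ∃ y, s = y + 1 := by
    refine (eq_zero_or_exists_eq_add_one s).resolve_left ?_
    rintro rfl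
    rw [hzero] at hs'
    exact not_lt_zero hs'
  have hy : N c y ≤ m := by
    have := hmin y (lt_add_one y)
    push Not at this
    obtain ⟨l, hl, h⟩ := this
    exact h ▸ lt_add_one_iff.1 hl
  have hAy : A c y := by
    by_contra h
    rw [hsame _ _ h] at hs'
    exact hs'.not_ge hy
  refine ⟨y, ?_, ?_, hAy, ?_⟩
  · by_contra! h
    exact (hs'.trans_le (count_mono hN hsucc hsame c (add_one_le_iff.2 h))).not_ge hb
  · by_contra! h
    exact (ht.trans_le (count_mono hN hsucc hsame c h)).not_ge hy
  · rw [hsucc _ _ hAy] at hs'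
    exact le_antisymm hy (lt_add_one_iff.1 hs')

/-! ### Σ⁰₁ induction implies `ERTAt` -/

/-- Treated apart because j is used below as modulus and base. The empty set is the required
sequence. -/
theorem ERTAt_zero : M.ERTAt 0 := by
  intro k F hF hfun
  refine ⟨0, fun x _ => ?_⟩
  have hG : {n : M.Num | n < 0} ∈ M.sets :=
    hM.out.comprehension (P := fun n => n < 0) (by repeat' constructor)
  exact ⟨_, hG, ⟨fun z hz => absurd hz (hM.out.not_lt_zero z),
    fun x hx => absurd hx (hM.out.not_lt_zero x)⟩,
    fun i i' y y' _ h => absurd h (hM.out.not_lt_zero _),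
    fun i y h => absurd h (hM.out.not_lt_zero _)⟩

/-- If the color `c` of `x` has at least `j` occurrences in `[b, t)`, as counted by `N`, then they
are enumerated in increasing order by a function of the model. -/
theorem occursAtLeast_of_count {F : Set M.Num} (hF : F ∈ M.sets) {N : M.Num → M.Num → M.Num}
    (hN : Def M fun x : Fin 3 → M.Num => N (x 0) (x 1) = x 2) (hzero : ∀ c, N c 0 = 0)
    (hsucc : ∀ c s, M.pair s c ∈ F → N c (s + 1) = N c s + 1)
    (hsame : ∀ c s, M.pair s c ∉ F → N c (s + 1) = N c s)
    {b t j c x : M.Num} (hx : M.pair x c ∈ F) (ht : N c b + j ≤ N c t) :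
    M.OccursAtLeast F b x j := by
  have hlt : ∀ {s t : M.Num}, s < t → M.pair s c ∈ F → N c s < N c t := fun h hs =>
    count_lt (A := fun c y => M.pair y c ∈ F) hN hsucc hsame c h hs
  -- The i-th term is the occurrence y of c in [b, t) that has N c b + i occurrences before it.
  obtain ⟨G, hG, hpair, hGiff⟩ := exists_set_of_pairs
    (R := fun i y => i < j ∧ (y < t ∧ (b < y + 1 ∧ (M.pair y c ∈ F ∧ N c y = N c b + i))))
    (by
      repeat' first
        | apply hN.subst₃ (P := fun c s m => N c s = m) | exact hF | constructor)
  refine ⟨G, hG, ⟨fun z hz => ?_, fun i hi => ?_⟩, fun i i' y y' hii h h' => ?_, fun i y h => ?_⟩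
  · obtain ⟨i, y, rfl⟩ := hpair z hz
    exact ⟨i, ((hGiff i y).1 hz).1, y, trivial, rfl⟩
  · have hi' : i < j := hi
    obtain ⟨y, hby, hyt, hyF, hy⟩ :=
      exists_count_eq (A := fun c y => M.pair y c ∈ F) hN hsucc hsame hzero c
        (le_self_add : N c b ≤ N c b + i) ((add_lt_add_right hi' (N c b)).trans_le ht)
    refine ⟨y, (hGiff i y).2 ⟨hi', hyt, lt_add_one_iff.2 hby, hyF, hy⟩, fun y' hy' => ?_⟩
    obtain ⟨-, -, -, hyF', hy'⟩ := (hGiff i y').1 hy'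
    have heq : N c y' = N c y := hy'.trans hy.symm
    rcases lt_trichotomy y y' with h | h | h
    · exact absurd heq (hlt h hyF).ne'
    · exact h.symm
    · exact absurd heq (hlt h hyF').ne
  · obtain ⟨-, -, -, hyF, hy⟩ := (hGiff i y).1 h
    obtain ⟨-, -, -, hyF', hy'⟩ := (hGiff i' y').1 h'
    by_contra hnot
    have hle : y' ≤ y := not_lt.1 hnot
    have hle' : N c y' ≤ N c y :=
      count_mono (A := fun c y => M.pair y c ∈ F) hN hsucc hsame c hle
    rw [hy, hy'] at hle'
    exact (le_of_add_le_add_left hle').not_gt hii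
  · obtain ⟨-, -, hby, hyF, -⟩ := (hGiff i y).1 h
    exact ⟨lt_add_one_iff.1 hby, c, hx, hyF⟩

/-- Let `t₀` bound the first occurrences of all vectors of numbers of occurrences modulo `j`, and
let `t` bound the first occurrences of all colors after each `b < t₀`. Some `b < t₀` has the same
vector as `t`, so that each color which occurs after `b` occurs at least `j` times in `[b, t)`. -/
theorem ERTAt_of_ISigma01 (hI : M.ISigma01) (j : M.Num) : M.ERTAt j := by
  rcases eq_or_ne j 0 with rfl | hj
  · exact ERTAt_zero
  replace hj : 0 < j := pos_iff_ne_zero.2 hj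
  intro k F hF hfun
  have hA : Def M fun x : Fin 2 → M.Num => M.pair (x 1) (x 0) ∈ F :=
    .mem hF (by repeat' constructor)
  obtain ⟨N, hN, hzero, hle, hsucc, hsame⟩ :=
    exists_counting_function (A := fun c y => M.pair y c ∈ F) hA
  -- The base j digit of P at c is the residue of N c s modulo j.
  let Vec : M.Num → M.Num → Prop := fun P s =>
    ∀ c, c < k → ∃ d, d < j ∧ (Digit j P c d ∧ ∃ q, q < s + 1 ∧ N c s = q * j + d)
  have hVec : Def M fun x : Fin 2 → M.Num => Vec (x 0) (x 1) := by
    repeat' first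
      | apply hN.subst₃ (P := fun c s m => N c s = m) | apply Def.digit | constructor
  have exists_vec : ∀ s, ∃ P, P < M.exp j k ∧ Vec P s := by
    intro s
    refine exists_code (h := fun c d => ∃ q, q < s + 1 ∧ N c s = q * j + d) ?_ k fun c _ => ?_
    · repeat' first | apply hN.subst₃ (P := fun c s m => N c s = m) | constructor
    · obtain ⟨q, d, hd, h⟩ := exists_div hj (N c s)
      refine ⟨d, hd, q, lt_add_one_iff.2 ?_, h⟩
      have h1 : (1 : M.Num) ≤ j := by simpa using add_one_le_iff.2 hj
      calc q ≤ q * j := le_mul_of_one_le_right' h1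
        _ ≤ N c s := h ▸ le_self_add
        _ ≤ s := hle c s
  obtain ⟨t₀, ht₀⟩ := hI.strong_collection hVec (M.exp j k)
  -- Collection has a single index, so b and c are packed into z. By monotonicity of pairing the
  -- bound covers all b < t₀ and c < k.
  obtain ⟨t, ht⟩ := hI.strong_collection
    (R := fun z s => ∃ b, b < z + 1 ∧ ∃ c, c < z + 1 ∧
      (z = M.pair b c ∧ (b < s + 1 ∧ M.pair s c ∈ F)))
    (by repeat' first | exact hF | constructor) (M.pair t₀ k + 1)
  obtain ⟨P, hP, hPt⟩ := exists_vec t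
  obtain ⟨b, hbt₀, hPb⟩ := ht₀ P hP t hPt
  refine ⟨b, fun x hbx => ?_⟩
  obtain ⟨c, hxc, -⟩ := hfun.2 x trivial
  have hck : c < k := by
    obtain ⟨x', -, c', hc', h⟩ := hfun.1 _ hxc
    obtain ⟨rfl, rfl⟩ := pair_inj h
    exact hc'
  obtain ⟨s, hst, b', -, c', -, hbc, hbs, hsF⟩ := ht (M.pair b c)
    (lt_add_one_iff.2 (pair_le_pair hbt₀.le hck.le)) x
    ⟨b, lt_add_one_iff.2 (left_le_pair b c), c, lt_add_one_iff.2 (right_le_pair b c), rfl,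
      lt_add_one_iff.2 hbx, hxc⟩
  obtain ⟨rfl, rfl⟩ := pair_inj hbc
  refine occursAtLeast_of_count hF hN hzero hsucc hsame hxc (t := t) ?_
  have hlt : N c b < N c t :=
    (count_mono (A := fun c y => M.pair y c ∈ F) hN hsucc hsame c (lt_add_one_iff.1 hbs)).trans_lt
      (count_lt (A := fun c y => M.pair y c ∈ F) hN hsucc hsame c hst hsF)
  obtain ⟨d, -, hd, q, -, hq⟩ := hPb c hck
  obtain ⟨d', -, hd', q', -, hq'⟩ := hPt c hck
  obtain rfl := hd.unique hd'
  rw [hq, hq'] at hlt ⊢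
  -- Equal residues d turn the strict inequality of counts into one of quotients, so the counts
  -- differ by at least j.
  have hqq : q < q' := lt_of_mul_lt_mul_right' (lt_of_add_lt_add_right hlt)
  calc q * j + d + j = (q + 1) * j + d := by ring
    _ ≤ q' * j + d := add_le_add_left (mul_le_mul_left (add_one_le_iff.2 hqq) j) d

end

end Model
end SecondOrderArith

theorem mainTheorem1 (M : SecondOrderArith.Model) (hM : M.RCA0Star) :
    List.TFAE [M.ISigma01, M.ERT, ∀ j : M.Num, M.ERTAt j] := by
  have : Fact M.RCA0Star := ⟨hM⟩
  tfae_have 1 → 3 := SecondOrderArith.Model.ERTAt_of_ISigma01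
  tfae_have 3 → 2 := SecondOrderArith.Model.ERT_of_forall_ERTAt
  tfae_have 2 → 1 := SecondOrderArith.Model.ISigma01_of_ERT
  tfae_finish
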